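/- Let $\mathbf{t} : \mathcal{D} \to \mathcal{T}$ be a logical refinement system: $\mathcal{D}$ and $\mathcal{T}$ are monoidal categories with partially defined left and right residuals, $\mathbf{t}$ is a strict monoidal functor, and whenever a residual is defined in $\mathcal{D}$, the corresponding residual is defined in $\mathcal{T}$ and $\mathbf{t}$ maps the former (object and evaluation map) strictly to the latter. Here a left residual $X\backslash Z$ is an object with an evaluation map $X\otimes (X\backslash Z)\to Z$ through which every $f : X\otimes Y\to Z$ factors by a unique $\lambda[f] : Y \to X\backslash Z$; right residuals $Z/Y$, with evaluation $(Z/Y)\otimes Y\to Z$ and curryings $\rho[f] : X\to Z/Y$, are defined symmetrically. Let $(W,p,e)$ be a monoid in $\mathcal{T}$, with multiplication $p : W\otimes W\to W$, and let $\mathcal{D}_W$ be the fiber of $\mathbf{t}$ over $W$. For $P,Q,R\in\mathcal{D}_W$ put $$P \multimap_W R := \lambda[p]^*(P\backslash R),\qquad R \mathbin{\circ\!\!-}_W Q := \rho[p]^*(R/Q),$$ whenever the residuals $P\backslash R$ (over $W\backslash W$) and $R/Q$ (over $W/W$) are defined and have these pullbacks, where a pullback $c^*S$ of $S$ along $c :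 A\to \mathbf{t}(S)$ is an object over $A$ with a (strongly) cartesian morphism $c^*S\to S$ over $c$. Let $W^+$ be the category whose objects are pairs $(X,c)$ with $X\in\mathcal{D}$ and $c : \mathbf{t}(X)\to W$, and whose morphisms $(X_1,c_1)\to(X_2,c_2)$ are morphisms $\alpha : X_1\to X_2$ with $c_1 = c_2\circ \mathbf{t}(\alpha)$. It carries the tensor product $(X_1,c_1)\bullet(X_2,c_2) = (X_1\otimes X_2,\ p\circ (c_1\otimes c_2))$. For $Q\in\mathcal{D}_W$ let $Q^+ : (W^+)^{\mathrm{op}}\to\mathbf{Set}$ be the presheaf sending $(X,c)$ to the set of morphisms $X\to Q$ lying over $c$; this defines a functor $(-)^+ : \mathcal{D}_W\to[(W^+)^{\mathrm{op}},\mathbf{Set}]$, acting on morphisms by composition. For presheaves $\phi,\psi,\omega$ on $W^+$ let $\phi\multimap_{W^+}\omega$ and $\omega \mathbin{\circ\!\!-}_{W^+}\psi$ be the presheaves $$x\mapsto \mathrm{Nat}(\phi,\ \omega(-\bullet x)),\qquad x\mapsto \mathrm{Nat}(\psi,\ \omega(x\bullet -)).$$ Then the functor $(-)^+$ preserves residuals: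 for all $P,Q,R\in\mathcal{D}_W$ such that the respective residuals and pullbacks exist, the canonical coercions $$(P\multimap_W R)^+\to P^+\multimap_{W^+}R^+,\qquad (R \mathbin{\circ\!\!-}_W Q)^+\to R^+ \mathbin{\circ\!\!-}_{W^+}Q^+$$ are isomorphisms of presheaves on $W^+$. Here the first coercion sends $\beta : X\to P\multimap_W R$ to the transformation taking $\alpha : Y\to P$ to the composite $Y\otimes X\to P\otimes(P\backslash R)\to R$ of $\alpha\otimes\beta$, the cartesian morphism $P\multimap_W R\to P\backslash R$, and evaluation; the second is defined symmetrically. -/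

import Mathlib

open CategoryTheory MonoidalCategory Functor.LaxMonoidal Functor.OplaxMonoidal

universe w v₁ v₂ u₁ u₂

namespace Refinement

section Residuals

variable {C : Type u₁} [Category.{v₁} C] [MonoidalCategory C]

/-- A left residual `X \ Z`: an object with an evaluation `X ⊗ (X \ Z) ⟶ Z` through which every
`f : X ⊗ Y ⟶ Z` factors by a unique `curry f : Y ⟶ X \ Z`. -/
structure LeftResidual (X Z : C) where
  obj : C
  plug : X ⊗ obj ⟶ Z
  curry {Y : C} (f : X ⊗ Y ⟶ Z) : Y ⟶ obj
  curry_plug {Y : C} (f : X ⊗ Y ⟶ Z) : X ◁ curry f ≫ plug = f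
  curry_uniq {Y : C} (g : Y ⟶ obj) : curry (X ◁ g ≫ plug) = g

/-- A right residual `Z / Y`: an object with an evaluation `(Z / Y) ⊗ Y ⟶ Z` through which every
`f : X ⊗ Y ⟶ Z` factors by a unique `curry f : X ⟶ Z / Y`. -/
structure RightResidual (Z Y : C) where
  obj : C
  plug : obj ⊗ Y ⟶ Z
  curry {X : C} (f : X ⊗ Y ⟶ Z) : X ⟶ obj
  curry_plug {X : C} (f : X ⊗ Y ⟶ Z) : curry f ▷ Y ≫ plug = f
  curry_uniq {X : C} (g : X ⟶ obj) : curry (g ▷ Y ≫ plug) = g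

variable (C) in
/-- Partial residuation operations on a monoidal category: `HasLeft X Z` (resp. `HasRight Z Y`) says
that `X \ Z` (resp. `Z / Y`) is defined. -/
class PartialResiduation where
  HasLeft : C → C → Prop
  left {X Z : C} : HasLeft X Z → LeftResidual X Z
  HasRight : C → C → Prop
  right {Z Y : C} : HasRight Z Y → RightResidual Z Y

end Residuals

open PartialResiduation

section Fibers

variable {D : Type u₁} [Category.{v₁} D] {T : Type u₂} [Category.{v₂} T]

/-- The object of `D` underlying a refinement of `A`. -/
abbrev carrier {t : D ⥤ T} {A : T} (P : t.Fiber A) : D := Functor.Fiber.fiberInclusion.obj P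

lemma obj_carrier {t : D ⥤ T} {A : T} (P : t.Fiber A) : t.obj (carrier P) = A := P.2

/-- A pullback of the refinement `Q` along `c : A ⟶ B`: a refinement of `A` with a strongly
cartesian morphism to `Q` lying over `c`. -/
structure Pullback (t : D ⥤ T) {A B : T} (c : A ⟶ B) (Q : D) where
  obj : t.Fiber A
  map : carrier obj ⟶ Q
  cartesian : t.IsStronglyCartesian c map

end Fibers

section Systems

variable {D : Type u₁} [Category.{v₁} D] [MonoidalCategory D]
  {T : Type u₂} [Category.{v₂} T] [MonoidalCategory T]

/-- A monoidal refinement system: a functor that strictly preserves tensor products and the unit,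
that is, a monoidal functor whose structure maps are identities. -/
class MonoidalRefinementSystem (t : D ⥤ T) [t.Monoidal] : Prop where
  obj_tensor (P Q : D) : t.obj P ⊗ t.obj Q = t.obj (P ⊗ Q)
  obj_unit : 𝟙_ T = t.obj (𝟙_ D)
  μ_eq (P Q : D) : μ t P Q = eqToHom (obj_tensor P Q)
  ε_eq : ε t = eqToHom obj_unit

/-- A logical refinement system: a monoidal refinement system that strictly preserves whatever
residuals are defined upstairs (both the objects and the evaluation maps). -/
class LogicalRefinementSystem (t : D ⥤ T) [t.Monoidal] [PartialResiduation D]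
    [PartialResiduation T] : Prop extends MonoidalRefinementSystem t where
  hasLeft {P R : D} : HasLeft P R → HasLeft (t.obj P) (t.obj R)
  left_obj {P R : D} (h : HasLeft P R) : t.obj (left h).obj = (left (hasLeft h)).obj
  left_plug {P R : D} (h : HasLeft P R) : t.IsHomLift (left (hasLeft h)).plug (left h).plug
  hasRight {R Q : D} : HasRight R Q → HasRight (t.obj R) (t.obj Q)
  right_obj {R Q : D} (h : HasRight R Q) : t.obj (right h).obj = (right (hasRight h)).obj
  right_plug {R Q : D} (h : HasRight R Q) : t.IsHomLift (right (hasRight h)).plug (right h).plug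

section Lemmas

variable (t : D ⥤ T) [t.Monoidal]

lemma isHomLift_tensor [MonoidalRefinementSystem t] {P₁ P₂ Q₁ Q₂ : D} {B₁ B₂ : T}
    {c₁ : t.obj P₁ ⟶ B₁} {c₂ : t.obj P₂ ⟶ B₂} {α₁ : P₁ ⟶ Q₁} {α₂ : P₂ ⟶ Q₂}
    (h₁ : t.IsHomLift c₁ α₁) (h₂ : t.IsHomLift c₂ α₂) :
    t.IsHomLift (δ t P₁ P₂ ≫ (c₁ ⊗ₘ c₂)) (α₁ ⊗ₘ α₂) := by
  have e₁ := IsHomLift.codomain_eq t c₁ α₁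
  have e₂ := IsHomLift.codomain_eq t c₂ α₂
  subst e₁ e₂
  obtain rfl := IsHomLift.eq_of_isHomLift t c₁ α₁
  obtain rfl := IsHomLift.eq_of_isHomLift t c₂ α₂
  have h : δ t P₁ P₂ ≫ (t.map α₁ ⊗ₘ t.map α₂) =
      t.map (α₁ ⊗ₘ α₂) ≫ eqToHom (MonoidalRefinementSystem.obj_tensor Q₁ Q₂).symm := by
    have := MonoidalRefinementSystem.μ_eq (t := t) Q₁ Q₂
    rw [← cancel_mono (μ t Q₁ Q₂)]
    simp [this]
    simp [← this]
  rw [h]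
  infer_instance

variable [PartialResiduation D] [PartialResiduation T] [LogicalRefinementSystem t]

lemma hasLeft_of_refines {P R : D} {A C : T} (hP : t.obj P = A) (hR : t.obj R = C)
    (h : HasLeft P R) : HasLeft A C := by
  subst hP hR; exact LogicalRefinementSystem.hasLeft h

lemma hasRight_of_refines {R Q : D} {C B : T} (hR : t.obj R = C) (hQ : t.obj Q = B)
    (h : HasRight R Q) : HasRight C B := by
  subst hQ hR; exact LogicalRefinementSystem.hasRight h

lemma isHomLift_leftPlug {P R : D} {A C : T} (hP : t.obj P = A) (hR : t.obj R = C)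
    (h : HasLeft P R) :
    t.IsHomLift (left (hasLeft_of_refines t hP hR h)).plug (left h).plug := by
  subst hP hR; exact LogicalRefinementSystem.left_plug h

lemma isHomLift_rightPlug {R Q : D} {C B : T} (hR : t.obj R = C) (hQ : t.obj Q = B)
    (h : HasRight R Q) :
    t.IsHomLift (right (hasRight_of_refines t hR hQ h)).plug (right h).plug := by
  subst hQ hR; exact LogicalRefinementSystem.right_plug h

end Lemmas

end Systems

section Presheaves

variable {A B C : Type*} [Category* A] [Category* B] [Category* C]

/-- The left currying `B ⥤ [A, C]` of a functor `A × B ⥤ C`. -/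
def lcurry (F : A × B ⥤ C) : B ⥤ A ⥤ C := Functor.curry.obj (CategoryTheory.Prod.swap B A ⋙ F)

/-- The right currying `A ⥤ [B, C]` of a functor `A × B ⥤ C`. -/
def rcurry (F : A × B ⥤ C) : A ⥤ B ⥤ C := Functor.curry.obj F

/-- Pullback of a presheaf along a functor: precomposition. -/
abbrev pshPullback (F : A ⥤ B) (ψ : Bᵒᵖ ⥤ Type w) : Aᵒᵖ ⥤ Type w := F.op ⋙ ψ

/-- The external residual of presheaves, a presheaf over the functor category `[A, C]`: it sends `F`
to the end `∀ a, φ a → ω (F a)`, that is, to the set of natural transformations from `φ` to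
the pullback of `ω` along `F`. As the tensor product of categories is symmetric, it serves both as the
left residual `φ \ ω` and as the right residual `ω / φ`. -/
def pshResidual (φ : Aᵒᵖ ⥤ Type w) (ω : Cᵒᵖ ⥤ Type w) : (A ⥤ C)ᵒᵖ ⥤ Type _ where
  obj F := φ ⟶ pshPullback F.unop ω
  map f := TypeCat.ofHom fun θ => θ ≫ Functor.whiskerRight (NatTrans.op f.unop) ω

end Presheaves

section Positive

variable {D : Type u₁} [Category.{v₁} D] {T : Type u₂} [Category.{v₂} T]

/-- The relative slice of `B`: objects are pairs `(P, c : t P ⟶ B)`, and morphisms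
`(P₁, c₁) ⟶ (P₂, c₂)` are the `α : P₁ ⟶ P₂` with `c₁ = t α ≫ c₂`. -/
abbrev Slice (t : D ⥤ T) (B : T) := CostructuredArrow t B

/-- The presheaf over the slice of `B` that represents a refinement `Q` of `B`: it sends `(P, c)` to
the set of morphisms `P ⟶ Q` lying over `c` (lifted to a universe that makes the presheaf
category closed). -/
def posPresheaf (t : D ⥤ T) {B : T} (Q : t.Fiber B) :
    (Slice t B)ᵒᵖ ⥤ Type (max u₁ v₁ v₂) where
  obj x := ULift.{max u₁ v₂} {α : x.unop.left ⟶ carrier Q // t.IsHomLift x.unop.hom α}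
  map {x y} f := TypeCat.ofHom fun α => ⟨f.unop.left ≫ α.down.1, by
    have := α.down.2
    rw [← CostructuredArrow.w f.unop]
    infer_instance⟩

/-- The positive representation restricted to the fiber of `W`. -/
def pos (t : D ⥤ T) (W : T) : t.Fiber W ⥤ (Slice t W)ᵒᵖ ⥤ Type (max u₁ v₁ v₂) where
  obj Q := posPresheaf t Q
  map {Q Q'} f :=
    { app x := TypeCat.ofHom fun α => ⟨α.down.1 ≫ Functor.Fiber.fiberInclusion.map f, by
        have := α.down.2
        infer_instance⟩
      naturality x y g := by
        ext α
        apply ULift.ext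
        apply Subtype.ext
        exact Category.assoc _ _ _ }
  map_id Q := by
    ext x α
    apply ULift.ext
    apply Subtype.ext
    exact Category.comp_id _
  map_comp f g := by
    ext x α
    apply ULift.ext
    apply Subtype.ext
    exact (Category.assoc _ _ _).symm

variable [MonoidalCategory D] [MonoidalCategory T] (t : D ⥤ T) [t.Monoidal]

/-- The functor sending `((P₁, c₁), (P₂, c₂))` to `(P₁ ⊗ P₂, c₁ ⊗ c₂)`. -/
def sliceTensor (B₁ B₂ : T) : Slice t B₁ × Slice t B₂ ⥤ Slice t (B₁ ⊗ B₂) where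
  obj x := CostructuredArrow.mk (Y := x.1.left ⊗ x.2.left)
    (δ t x.1.left x.2.left ≫ (x.1.hom ⊗ₘ x.2.hom))
  map {x y} f := CostructuredArrow.homMk (f.1.left ⊗ₘ f.2.left) (by
    have h : (x.1.hom ⊗ₘ x.2.hom) =
        (t.map f.1.left ⊗ₘ t.map f.2.left) ≫ (y.1.hom ⊗ₘ y.2.hom) := by
      rw [MonoidalCategory.tensorHom_comp_tensorHom, CostructuredArrow.w, CostructuredArrow.w]
    change t.map (f.1.left ⊗ₘ f.2.left) ≫ δ t y.1.left y.2.left ≫ (y.1.hom ⊗ₘ y.2.hom) =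
      δ t x.1.left x.2.left ≫ (x.1.hom ⊗ₘ x.2.hom)
    rw [h, δ_natural_assoc])
  map_id x := by ext; simp
  map_comp f g := by ext; simp

/-- The tensor product that the slice of a monoid `W` inherits from `W`. -/
def monoidTensor (W : T) [MonObj W] : Slice t W × Slice t W ⥤ Slice t W :=
  sliceTensor t W W ⋙ CostructuredArrow.map (MonObj.mul : W ⊗ W ⟶ W)

/-- The left residual `φ ⊸ ω` of presheaves over the slice of `W`: the pullback of the external
residual `φ \ ω` along the left currying of the tensor product. -/
def sliceImpL (W : T) [MonObj W] (φ ω : (Slice t W)ᵒᵖ ⥤ Type (max u₁ v₁ v₂)) :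
    (Slice t W)ᵒᵖ ⥤ Type (max u₁ v₁ v₂) :=
  pshPullback (lcurry (monoidTensor t W)) (pshResidual φ ω)

/-- The right residual `ω ⟜ ψ` of presheaves over the slice of `W`: the pullback of the external
residual `ω / ψ` along the right currying of the tensor product. -/
def sliceImpR (W : T) [MonObj W] (ω ψ : (Slice t W)ᵒᵖ ⥤ Type (max u₁ v₁ v₂)) :
    (Slice t W)ᵒᵖ ⥤ Type (max u₁ v₁ v₂) :=
  pshPullback (rcurry (monoidTensor t W)) (pshResidual ψ ω)

variable [PartialResiduation D] [PartialResiduation T] [LogicalRefinementSystem t]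
  {W : T} [MonObj W]

/-- A fiberwise left residual `P ⊸ R` over a monoid `W`: the residual `P \ R` is defined, and its
pullback along the left currying `W ⟶ W \ W` of the multiplication is given. -/
structure LeftImplication (P R : t.Fiber W) where
  hasLeft : HasLeft (carrier P) (carrier R)
  pullback : Pullback t
    ((left (hasLeft_of_refines t (obj_carrier P) (obj_carrier R) hasLeft)).curry
      (MonObj.mul : W ⊗ W ⟶ W))
    (left hasLeft).obj

/-- A fiberwise right residual `R ⟜ Q` over a monoid `W`: the residual `R / Q` is defined, and its
pullback along the right currying `W ⟶ W / W` of the multiplication is given. -/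
structure RightImplication (R Q : t.Fiber W) where
  hasRight : HasRight (carrier R) (carrier Q)
  pullback : Pullback t
    ((right (hasRight_of_refines t (obj_carrier R) (obj_carrier Q) hasRight)).curry
      (MonObj.mul : W ⊗ W ⟶ W))
    (right hasRight).obj

variable {t}

namespace LeftImplication

variable {P R : t.Fiber W} (I : LeftImplication t P R)

/-- The refinement `P ⊸ R` of `W`. -/
abbrev obj : t.Fiber W := I.pullback.obj

/-- From `α : Y ⟶ P` over `d` and `β : X ⟶ (P ⊸ R)` over `c`, the composite
`Y ⊗ X ⟶ P ⊗ (P \ R) ⟶ R` lies over `(d ⊗ c) ≫ mul`. -/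
lemma isHomLift_apply {Y X : D} {d : t.obj Y ⟶ W} {c : t.obj X ⟶ W} {α : Y ⟶ carrier P}
    {β : X ⟶ carrier I.obj} (hα : t.IsHomLift d α) (hβ : t.IsHomLift c β) :
    t.IsHomLift ((δ t Y X ≫ (d ⊗ₘ c)) ≫ MonObj.mul)
      ((α ⊗ₘ (β ≫ I.pullback.map)) ≫ (left I.hasLeft).plug) := by
  have hI := I.pullback.cartesian.toIsHomLift
  have h := isHomLift_leftPlug t (obj_carrier P) (obj_carrier R) I.hasLeft
  have hc := IsHomLift.comp t c ((left (hasLeft_of_refines t (obj_carrier P) (obj_carrier R) I.hasLeft)).curry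
    (MonObj.mul : W ⊗ W ⟶ W)) β I.pullback.map
  have h' := isHomLift_tensor t hα hc
  have e : (d ⊗ₘ c) ≫ MonObj.mul = (d ⊗ₘ (c ≫ (left (hasLeft_of_refines t (obj_carrier P) (obj_carrier R)
      I.hasLeft)).curry (MonObj.mul : W ⊗ W ⟶ W))) ≫ (left (hasLeft_of_refines t (obj_carrier P) (obj_carrier R)
      I.hasLeft)).plug := by
    conv_lhs => rw [← (left (hasLeft_of_refines t (obj_carrier P) (obj_carrier R) I.hasLeft)).curry_plug
      (MonObj.mul : W ⊗ W ⟶ W)]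
    simp [MonoidalCategory.tensorHom_def]
  rw [Category.assoc, e, ← Category.assoc]
  infer_instance

/-- The canonical coercion `pos (P ⊸ R) ⟶ (pos P ⊸ pos R)`: it sends `β : X ⟶ (P ⊸ R)` to the
transformation that takes `α : Y ⟶ P` to the composite `Y ⊗ X ⟶ P ⊗ (P \ R) ⟶ R`. -/
def coercion : (pos t W).obj I.obj ⟶ sliceImpL t W ((pos t W).obj P) ((pos t W).obj R) where
  app x := TypeCat.ofHom fun β =>
    { app y := TypeCat.ofHom fun α =>
        ⟨(α.down.1 ⊗ₘ (β.down.1 ≫ I.pullback.map)) ≫ (left I.hasLeft).plug,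
          I.isHomLift_apply α.down.2 β.down.2⟩
      naturality y z f := by
        ext α
        apply ULift.ext
        apply Subtype.ext
        change ((f.unop.left ≫ α.down.1) ⊗ₘ (β.down.1 ≫ I.pullback.map)) ≫ _ =
          (f.unop.left ⊗ₘ 𝟙 x.unop.left) ≫ (α.down.1 ⊗ₘ (β.down.1 ≫ I.pullback.map)) ≫ _
        rw [MonoidalCategory.tensorHom_comp_tensorHom_assoc, Category.id_comp] }
  naturality x z f := by
    ext β
    apply NatTrans.ext
    ext y α
    apply ULift.ext
    apply Subtype.ext
    change (α.down.1 ⊗ₘ ((f.unop.left ≫ β.down.1) ≫ I.pullback.map)) ≫ _ =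
      (𝟙 y.unop.left ⊗ₘ f.unop.left) ≫ (α.down.1 ⊗ₘ (β.down.1 ≫ I.pullback.map)) ≫ _
    simp only [MonoidalCategory.tensorHom_comp_tensorHom_assoc, Category.id_comp, Category.assoc]

end LeftImplication

namespace RightImplication

variable {R Q : t.Fiber W} (I : RightImplication t R Q)

/-- The refinement `R ⟜ Q` of `W`. -/
abbrev obj : t.Fiber W := I.pullback.obj

/-- From `β : X ⟶ (R ⟜ Q)` over `c` and `α : Y ⟶ Q` over `d`, the composite
`X ⊗ Y ⟶ (R / Q) ⊗ Q ⟶ R` lies over `(c ⊗ d) ≫ mul`. -/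
lemma isHomLift_apply {X Y : D} {c : t.obj X ⟶ W} {d : t.obj Y ⟶ W} {β : X ⟶ carrier I.obj}
    {α : Y ⟶ carrier Q} (hβ : t.IsHomLift c β) (hα : t.IsHomLift d α) :
    t.IsHomLift ((δ t X Y ≫ (c ⊗ₘ d)) ≫ MonObj.mul)
      (((β ≫ I.pullback.map) ⊗ₘ α) ≫ (right I.hasRight).plug) := by
  have hI := I.pullback.cartesian.toIsHomLift
  have h := isHomLift_rightPlug t (obj_carrier R) (obj_carrier Q) I.hasRight
  have hc := IsHomLift.comp t c ((right (hasRight_of_refines t (obj_carrier R) (obj_carrier Q) I.hasRight)).curry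
    (MonObj.mul : W ⊗ W ⟶ W)) β I.pullback.map
  have h' := isHomLift_tensor t hc hα
  have e : (c ⊗ₘ d) ≫ MonObj.mul = ((c ≫ (right (hasRight_of_refines t (obj_carrier R) (obj_carrier Q)
      I.hasRight)).curry (MonObj.mul : W ⊗ W ⟶ W)) ⊗ₘ d) ≫ (right (hasRight_of_refines t (obj_carrier R) (obj_carrier Q)
      I.hasRight)).plug := by
    conv_lhs => rw [← (right (hasRight_of_refines t (obj_carrier R) (obj_carrier Q) I.hasRight)).curry_plug
      (MonObj.mul : W ⊗ W ⟶ W)]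
    simp [MonoidalCategory.tensorHom_def']
  rw [Category.assoc, e, ← Category.assoc]
  infer_instance

/-- The canonical coercion `pos (R ⟜ Q) ⟶ (pos R ⟜ pos Q)`: it sends `β : X ⟶ (R ⟜ Q)` to the
transformation that takes `α : Y ⟶ Q` to the composite `X ⊗ Y ⟶ (R / Q) ⊗ Q ⟶ R`. -/
def coercion : (pos t W).obj I.obj ⟶ sliceImpR t W ((pos t W).obj R) ((pos t W).obj Q) where
  app x := TypeCat.ofHom fun β =>
    { app y := TypeCat.ofHom fun α =>
        ⟨((β.down.1 ≫ I.pullback.map) ⊗ₘ α.down.1) ≫ (right I.hasRight).plug,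
          I.isHomLift_apply β.down.2 α.down.2⟩
      naturality y z f := by
        ext α
        apply ULift.ext
        apply Subtype.ext
        change ((β.down.1 ≫ I.pullback.map) ⊗ₘ (f.unop.left ≫ α.down.1)) ≫ _ =
          (𝟙 x.unop.left ⊗ₘ f.unop.left) ≫ ((β.down.1 ≫ I.pullback.map) ⊗ₘ α.down.1) ≫ _
        rw [MonoidalCategory.tensorHom_comp_tensorHom_assoc, Category.id_comp] }
  naturality x z f := by
    ext β
    apply NatTrans.ext
    ext y α
    apply ULift.ext
    apply Subtype.ext
    change (((f.unop.left ≫ β.down.1) ≫ I.pullback.map) ⊗ₘ α.down.1) ≫ _ =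
      (f.unop.left ⊗ₘ 𝟙 y.unop.left) ≫ ((β.down.1 ≫ I.pullback.map) ⊗ₘ α.down.1) ≫ _
    simp only [MonoidalCategory.tensorHom_comp_tensorHom_assoc, Category.id_comp, Category.assoc]

end RightImplication

end Positive

end Refinement

/-! The presheaf `Q⁺` is representable: a morphism `Y ⟶ Q` over `d` is the same as a morphism `(Y,
d) ⟶ (Q, id)` of the slice. By Yoneda, a transformation `P⁺ ⟶ R⁺(- • (X, c))` is determined by its
value at the identity of `P`, which can be any morphism `P ⊗ X ⟶ R` over `(id ⊗ c) ≫ mul`. Currying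
turns these into the morphisms `X ⟶ P \ R` over `c ≫ λ[mul]`, and the cartesian morphism turns those
into the morphisms `X ⟶ (P ⊸ R)` over `c`. The coercion, evaluated at the identity of `P`, runs this
chain backwards, so each of its components is bijective. The step that needs strict preservation of
residuals is that currying in `D` lies over currying in `T` (`isHomLift_leftCurry`,
`isHomLift_rightCurry`). The right-hand case is the mirror image. -/

namespace Refinement

open PartialResiduation

section Currying

variable {C : Type u₁} [Category.{v₁} C] [MonoidalCategory C]

lemma LeftResidual.hom_ext {X Z Y : C} (L : LeftResidual X Z) {g g' : Y ⟶ L.obj}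
    (h : X ◁ g ≫ L.plug = X ◁ g' ≫ L.plug) : g = g' := by
  rw [← L.curry_uniq g, h, L.curry_uniq]

lemma RightResidual.hom_ext {Z Y X : C} (L : RightResidual Z Y) {g g' : X ⟶ L.obj}
    (h : g ▷ Y ≫ L.plug = g' ▷ Y ≫ L.plug) : g = g' := by
  rw [← L.curry_uniq g, h, L.curry_uniq]

end Currying

/-! ### Compatibility of currying with the refinement functor. -/

section Lifting

variable {D : Type u₁} [Category.{v₁} D] [MonoidalCategory D]
  {T : Type u₂} [Category.{v₂} T] [MonoidalCategory T]
  (t : D ⥤ T) [t.Monoidal] [PartialResiduation D] [PartialResiduation T]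
  [LogicalRefinementSystem t]

/-- Left currying upstairs lies over left currying downstairs. -/
lemma isHomLift_leftCurry {P R X : D} {A B C : T} (hP : t.obj P = A) (hR : t.obj R = C)
    (h : HasLeft P R) {c : t.obj X ⟶ B} {g : A ⊗ B ⟶ C} {f : P ⊗ X ⟶ R}
    (hf : t.IsHomLift ((δ t P X ≫ (eqToHom hP ⊗ₘ c)) ≫ g) f) :
    t.IsHomLift (c ≫ (left (hasLeft_of_refines t hP hR h)).curry g) ((left h).curry f) := by
  subst hP hR
  have hplug := isHomLift_leftPlug t rfl rfl h
  -- Here `k` is the image of the curried morphism, with its codomain transported along the equality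
  -- of residuals. It remains to identify `k` with `c ≫ λ[g]`.
  obtain ⟨k, hk⟩ : ∃ k : t.obj X ⟶ (left (hasLeft_of_refines t rfl rfl h)).obj,
      t.IsHomLift k ((left h).curry f) :=
    ⟨t.map ((left h).curry f) ≫ eqToHom (LogicalRefinementSystem.left_obj h), inferInstance⟩
  have hid : t.IsHomLift (𝟙 (t.obj P)) (𝟙 P) := by infer_instance
  have htensor := isHomLift_tensor t hid hk
  have hcomp := IsHomLift.comp t (δ t P X ≫ (𝟙 _ ⊗ₘ k))
    (left (hasLeft_of_refines t rfl rfl h)).plug (𝟙 P ⊗ₘ (left h).curry f) (left h).plug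
  rw [id_tensorHom, id_tensorHom, (left h).curry_plug] at hcomp
  -- The uncurrying of `k` and the composite given in `hf` both lie under `f`, so both equal `t.map
  -- f`.
  have e := (@IsHomLift.eq_of_isHomLift _ _ _ _ t _ _ _ f hcomp).trans
    (@IsHomLift.eq_of_isHomLift _ _ _ _ t _ _ _ f hf).symm
  suffices k = c ≫ (left (hasLeft_of_refines t rfl rfl h)).curry g by rwa [← this]
  -- Morphisms into a residual are compared after uncurrying, and `δ` is invertible, so the claim
  -- reduces to `e`.
  apply LeftResidual.hom_ext
  rw [whiskerLeft_comp, Category.assoc, LeftResidual.curry_plug,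
    ← cancel_epi (δ t P X)]
  simpa using e

/-- Right currying upstairs lies over right currying downstairs. -/
lemma isHomLift_rightCurry {R Q X : D} {A B C : T} (hR : t.obj R = C) (hQ : t.obj Q = A)
    (h : HasRight R Q) {c : t.obj X ⟶ B} {g : B ⊗ A ⟶ C} {f : X ⊗ Q ⟶ R}
    (hf : t.IsHomLift ((δ t X Q ≫ (c ⊗ₘ eqToHom hQ)) ≫ g) f) :
    t.IsHomLift (c ≫ (right (hasRight_of_refines t hR hQ h)).curry g) ((right h).curry f) := by
  subst hQ hR
  have hplug := isHomLift_rightPlug t rfl rfl h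
  obtain ⟨k, hk⟩ : ∃ k : t.obj X ⟶ (right (hasRight_of_refines t rfl rfl h)).obj,
      t.IsHomLift k ((right h).curry f) :=
    ⟨t.map ((right h).curry f) ≫ eqToHom (LogicalRefinementSystem.right_obj h), inferInstance⟩
  have hid : t.IsHomLift (𝟙 (t.obj Q)) (𝟙 Q) := by infer_instance
  have htensor := isHomLift_tensor t hk hid
  have hcomp := IsHomLift.comp t (δ t X Q ≫ (k ⊗ₘ 𝟙 _))
    (right (hasRight_of_refines t rfl rfl h)).plug ((right h).curry f ⊗ₘ 𝟙 Q) (right h).plug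
  rw [tensorHom_id, tensorHom_id, (right h).curry_plug] at hcomp
  -- Two morphisms of `T` with the same lift `f` coincide; uniqueness of currying then determines
  -- `k`.
  have e := (@IsHomLift.eq_of_isHomLift _ _ _ _ t _ _ _ f hcomp).trans
    (@IsHomLift.eq_of_isHomLift _ _ _ _ t _ _ _ f hf).symm
  suffices k = c ≫ (right (hasRight_of_refines t rfl rfl h)).curry g by rwa [← this]
  apply RightResidual.hom_ext
  rw [comp_whiskerRight, Category.assoc, RightResidual.curry_plug,
    ← cancel_epi (δ t X Q)]
  simpa using e

end Lifting

/-! ### Representability of `P⁺` and the universal property of pullbacks. -/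

section Fibers

variable {D : Type u₁} [Category.{v₁} D] {T : Type u₂} [Category.{v₂} T] {t : D ⥤ T} {W : T}

/-- A refinement of `W`, seen as an object of the slice of `W`. -/
abbrev sliceOf (P : t.Fiber W) : Slice t W :=
  CostructuredArrow.mk (Y := carrier P) (eqToHom (obj_carrier P))

/-- The element of the presheaf of `P` given by the identity of `P`. -/
def genericElement (P : t.Fiber W) : ((pos t W).obj P).obj (Opposite.op (sliceOf P)) :=
  ⟨𝟙 (carrier P), IsHomLift.id_lift_eqToHom_domain (obj_carrier P) rfl⟩

/-- Every morphism into `P` lying over an object of the slice is a morphism of the slice. -/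
def sliceHomOfLift {P : t.Fiber W} {y : Slice t W} (α : y.left ⟶ carrier P)
    (hα : t.IsHomLift y.hom α) : y ⟶ sliceOf P :=
  CostructuredArrow.homMk α (by
    change t.map α ≫ eqToHom (obj_carrier P) = y.hom
    have := IsHomLift.fac t y.hom α
    simpa using this.symm)

/-- Lifts through a pullback are unique. -/
lemma Pullback.hom_ext {A B : T} {c : A ⟶ B} {Q : D} (S : Pullback t c Q) {X : D}
    {d : t.obj X ⟶ A} {β β' : X ⟶ carrier S.obj} (hβ : t.IsHomLift d β)
    (hβ' : t.IsHomLift d β') (h : β ≫ S.map = β' ≫ S.map) : β = β' := by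
  have := S.cartesian
  exact Functor.IsStronglyCartesian.ext t c S.map d h

/-- Every morphism over `d ≫ c` lifts through a pullback along `c`. -/
lemma Pullback.exists_lift {A B : T} {c : A ⟶ B} {Q : D} (S : Pullback t c Q) {X : D}
    {d : t.obj X ⟶ A} {γ : X ⟶ Q} (hγ : t.IsHomLift (d ≫ c) γ) :
    ∃ β : X ⟶ carrier S.obj, t.IsHomLift d β ∧ β ≫ S.map = γ := by
  have := S.cartesian
  exact (Functor.IsStronglyCartesian.universal_property t c S.map d _ rfl γ).exists

end Fibers

/-! ### Bijectivity of the coercions by the Yoneda argument. -/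

section Coercions

variable {D : Type u₁} [Category.{v₁} D] [MonoidalCategory D]
  {T : Type u₂} [Category.{v₂} T] [MonoidalCategory T]
  {t : D ⥤ T} [t.Monoidal] [PartialResiduation D] [PartialResiduation T]
  [LogicalRefinementSystem t] {W : T} [MonObj W]

/-- Injectivity evaluates at the generic element, then cancels evaluation and the cartesian
morphism. Surjectivity curries the value of the transformation there, lifts it through the pullback,
and recovers the other values by naturality. -/
theorem LeftImplication.coercion_app_bijective {P R : t.Fiber W} (I : LeftImplication t P R)
    (x : (Slice t W)ᵒᵖ) : Function.Bijective (I.coercion.app x) := by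
  constructor
  · intro β β' h
    have h₁ := congrArg (fun θ : (pos t W).obj P ⟶
      pshPullback ((lcurry (monoidTensor t W)).obj x.unop) ((pos t W).obj R) =>
      (θ.app (Opposite.op (sliceOf P)) (genericElement P)).down.1) h
    replace h₁ : (𝟙 (carrier P) ⊗ₘ (β.down.1 ≫ I.pullback.map)) ≫ (left I.hasLeft).plug =
      (𝟙 (carrier P) ⊗ₘ (β'.down.1 ≫ I.pullback.map)) ≫ (left I.hasLeft).plug := h₁
    rw [id_tensorHom, id_tensorHom] at h₁
    exact ULift.ext _ _ (Subtype.ext (I.pullback.hom_ext β.down.2 β'.down.2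
      (LeftResidual.hom_ext _ h₁)))
  · intro θ
    let θ' : (pos t W).obj P ⟶
      pshPullback ((lcurry (monoidTensor t W)).obj x.unop) ((pos t W).obj R) := θ
    let f := θ'.app (Opposite.op (sliceOf P)) (genericElement P)
    obtain ⟨β, hβ, hβf⟩ := I.pullback.exists_lift
      (isHomLift_leftCurry t (obj_carrier P) (obj_carrier R) I.hasLeft f.down.2)
    refine ⟨⟨β, hβ⟩, ?_⟩
    apply NatTrans.ext
    ext y α
    -- Yoneda: `α` is the restriction of the generic element along `α` itself, seen as a slice
    -- morphism into `(P, id)`, so naturality expresses `θ'` at `α` through `f`.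
    have hnat := congrArg (fun z => z.down.1)
      (ConcreteCategory.congr_hom (θ'.naturality (sliceHomOfLift α.down.1 α.down.2).op)
        (genericElement P))
    replace hnat : (θ'.app y ⟨α.down.1 ≫ 𝟙 (carrier P), _⟩).down.1 =
      (α.down.1 ⊗ₘ 𝟙 x.unop.left) ≫ f.down.1 := hnat
    apply ULift.ext
    apply Subtype.ext
    change (α.down.1 ⊗ₘ (β ≫ I.pullback.map)) ≫ (left I.hasLeft).plug = (θ'.app y α).down.1
    simp only [Category.comp_id] at hnat
    refine Eq.trans ?_ hnat.symm
    -- Splitting the tensor with `α` first isolates the evaluation of a curried morphism, which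
    -- returns `f`.
    rw [hβf, MonoidalCategory.tensorHom_def, Category.assoc, tensorHom_id]
    congr 1
    exact (left I.hasLeft).curry_plug _

/-- The same argument with `Q` tensored on the right: the generic element of `Q` gives a morphism `X
⊗ Q ⟶ R`, which is right-curried and lifted. -/
theorem RightImplication.coercion_app_bijective {R Q : t.Fiber W} (I : RightImplication t R Q)
    (x : (Slice t W)ᵒᵖ) : Function.Bijective (I.coercion.app x) := by
  constructor
  · intro β β' h
    have h₁ := congrArg (fun θ : (pos t W).obj Q ⟶
      pshPullback ((rcurry (monoidTensor t W)).obj x.unop) ((pos t W).obj R) =>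
      (θ.app (Opposite.op (sliceOf Q)) (genericElement Q)).down.1) h
    replace h₁ : ((β.down.1 ≫ I.pullback.map) ⊗ₘ 𝟙 (carrier Q)) ≫ (right I.hasRight).plug =
      ((β'.down.1 ≫ I.pullback.map) ⊗ₘ 𝟙 (carrier Q)) ≫ (right I.hasRight).plug := h₁
    rw [tensorHom_id, tensorHom_id] at h₁
    exact ULift.ext _ _ (Subtype.ext (I.pullback.hom_ext β.down.2 β'.down.2
      (RightResidual.hom_ext _ h₁)))
  · intro θ
    let θ' : (pos t W).obj Q ⟶
      pshPullback ((rcurry (monoidTensor t W)).obj x.unop) ((pos t W).obj R) := θ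
    let f := θ'.app (Opposite.op (sliceOf Q)) (genericElement Q)
    obtain ⟨β, hβ, hβf⟩ := I.pullback.exists_lift
      (isHomLift_rightCurry t (obj_carrier R) (obj_carrier Q) I.hasRight f.down.2)
    refine ⟨⟨β, hβ⟩, ?_⟩
    apply NatTrans.ext
    ext y α
    have hnat := congrArg (fun z => z.down.1)
      (ConcreteCategory.congr_hom (θ'.naturality (sliceHomOfLift α.down.1 α.down.2).op)
        (genericElement Q))
    replace hnat : (θ'.app y ⟨α.down.1 ≫ 𝟙 (carrier Q), _⟩).down.1 =
      (𝟙 x.unop.left ⊗ₘ α.down.1) ≫ f.down.1 := hnat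
    apply ULift.ext
    apply Subtype.ext
    change ((β ≫ I.pullback.map) ⊗ₘ α.down.1) ≫ (right I.hasRight).plug = (θ'.app y α).down.1
    simp only [Category.comp_id] at hnat
    refine Eq.trans ?_ hnat.symm
    -- The primed decomposition is needed here, since `α` now acts on the right factor and must come
    -- first.
    rw [hβf, MonoidalCategory.tensorHom_def', Category.assoc, id_tensorHom]
    congr 1
    exact (right I.hasRight).curry_plug _

end Coercions

end Refinement

theorem mainTheorem9 {D : Type u₁} [Category.{v₁} D] [MonoidalCategory D]
    {T : Type u₂} [Category.{v₂} T] [MonoidalCategory T]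
    [Refinement.PartialResiduation D] [Refinement.PartialResiduation T]
    (t : D ⥤ T) [t.Monoidal] [Refinement.LogicalRefinementSystem t] (W : T) [MonObj W] :
    (∀ (P R : t.Fiber W) (I : Refinement.LeftImplication t P R), IsIso I.coercion) ∧
    (∀ (R Q : t.Fiber W) (I : Refinement.RightImplication t R Q), IsIso I.coercion) := by
  constructor
  · intro P R I
    rw [NatTrans.isIso_iff_isIso_app]
    exact fun x => (isIso_iff_bijective _).2 (I.coercion_app_bijective x)
  · intro R Q I
    rw [NatTrans.isIso_iff_isIso_app]
    exact fun x => (isIso_iff_bijective _).2 (I.coercion_app_bijective x)
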